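/- **The $\frac\pi4$-fragment of the ZX-calculus is not complete; in other words, the ZX-calculus is incomplete for Clifford+T quantum mechanics.** *Diagrams.* ZX-diagrams $D:n\to m$ ($n$ inputs, $m$ outputs) are generated by green dots $R_Z^{(n,m)}(\alpha):n\to m$ and red dots $R_X^{(n,m)}(\alpha):n\to m$ ($n,m\in\mathbb N$, $\alpha\in\mathbb R/2\pi\mathbb Z$; angle omitted when $0$), $H:1\to1$, the empty diagram $e:0\to0$, the wire $\mathbb I:1\to1$, the crossing $\sigma:2\to2$, $\epsilon:2\to0$, $\eta:0\to2$, under juxtaposition $\otimes$ and sequential composition $\circ$. The $\frac\pi4$-fragment consists of the diagrams all of whose angles are multiples of $\frac\pi4$. *Standard interpretation.* $[\![D]\!]:\mathbb C^{2^n}\to\mathbb C^{2^m}$ sends $\otimes,\circ$ to Kronecker and matrix product, $e,\mathbb I$ to identities, $\sigma$ to the swap, $\eta$ to $|00\rangle+|11\rangle$, $\epsilon$ to its transpose, $H$ to $\frac1{\sqrt2}\begin{pmatrix}1&1\\1&-1\end{pmatrix}$, $R_Z^{(n,m)}(\alpha)$ to $|0^m\rangle\langle0^n|+e^{i\alpha}|1^m\rangle\langle1^n|$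 (so $1+e^{i\alpha}$ if $n=m=0$), and $R_X^{(n,m)}(\alpha)$ to $[\![H]\!]^{\otimes m}[\![R_Z^{(n,m)}(\alpha)]\!][\![H]\!]^{\otimes n}$. *Calculus.* $ZX\vdash D_1=D_2$ is the least equivalence relation closed under $\otimes$ and $\circ$, that contains all deformations of diagrams ("only topology matters": the laws of strict compact closed symmetric monoidal categories; legs of a dot may be interchanged and bent, and the legs of $H$ bent) and the following rules together with their colour-swapped and/or upside-down versions. Write $s_k=R_X^{(k,0)}\circ R_Z^{(0,k)}$. - (S1) two green dots of angles $\alpha,\beta$ joined by at least one wire merge into a green dot of angle $\alpha+\beta$; - (S2) $R_Z^{(1,1)}(0)=\mathbb I$; (S3) $R_Z^{(0,2)}(0)=\eta$; - (B1) $s_1\otimes(R_Z^{(1,2)}\circ R_X^{(0,1)})=R_X^{(0,1)}\otimes R_X^{(0,1)}$; - (B2) $s_1\otimes\big((R_X^{(2,1)}\otimes R_X^{(2,1)})\circ(\mathbb I\otimes\sigma\otimes\mathbb I)\circ(R_Z^{(1,2)}\otimes R_Z^{(1,2)})\big)=R_Z^{(1,2)}\circ R_X^{(2,1)}$; - (K1)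 $R_Z^{(1,n)}\circ R_X^{(1,1)}(\pi)=R_X^{(1,1)}(\pi)^{\otimes n}\circ R_Z^{(1,n)}$ for all $n$; - (K2) $s_1\otimes(R_X^{(1,1)}(\pi)\circ R_Z^{(1,1)}(\alpha))=(R_X^{(1,0)}(\pi)\circ R_Z^{(0,1)}(\alpha))\otimes(R_Z^{(1,1)}(-\alpha)\circ R_X^{(1,1)}(\pi))$; - (EU) $H=R_Z^{(0,0)}(-\frac\pi2)\otimes s_3\otimes(R_Z^{(1,1)}(\frac\pi2)\circ R_X^{(1,1)}(\frac\pi2)\circ R_Z^{(1,1)}(\frac\pi2))$; - (H) $H^{\otimes m}\circ R_Z^{(n,m)}(\alpha)\circ H^{\otimes n}=R_X^{(n,m)}(\alpha)$; - (IV) $s_3\otimes s_1=e$; (ZO) $R_Z^{(0,0)}(\pi)\otimes\mathbb I=R_Z^{(0,0)}(\pi)\otimes(R_X^{(0,1)}\circ R_Z^{(1,0)})$. *Claim.* For $\alpha=\frac\pi4$ the two sides of the supplementarity equation $$R_X^{(2,1)}\circ\big(R_Z^{(0,1)}(\alpha)\otimes R_Z^{(0,1)}(\alpha+\pi)\big)\;=\;R_X^{(2,1)}\circ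 R_Z^{(0,2)}(2\alpha+\pi)$$ belong to the $\frac\pi4$-fragment and have the same standard interpretation, but the equation is not derivable in the ZX-calculus (even by derivations through diagrams with arbitrary angles). Consequently the $\frac\pi4$-fragment is not complete: it is not true that $[\![D_1]\!]=[\![D_2]\!]$ implies $ZX\vdash D_1=D_2$ for all diagrams $D_1,D_2:n\to m$ of the $\frac\pi4$-fragment. -/

import Mathlib

noncomputable section

namespace ZX

/-- ZX-diagrams `n → m` with `n` inputs and `m` outputs. Angles live in `ℝ / 2πℤ`. -/
inductive Diagram : ℕ → ℕ → Type
  /-- green dot with `n` inputs and `m` outputs -/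
  | Z (n m : ℕ) (α : Real.Angle) : Diagram n m
  /-- red dot with `n` inputs and `m` outputs -/
  | X (n m : ℕ) (α : Real.Angle) : Diagram n m
  /-- Hadamard vertex -/
  | H : Diagram 1 1
  /-- the empty diagram -/
  | empty : Diagram 0 0
  /-- a single wire -/
  | wire : Diagram 1 1
  /-- crossing of two wires -/
  | swap : Diagram 2 2
  /-- the generator `ε` -/
  | cup : Diagram 2 0
  /-- the generator `η` -/
  | cap : Diagram 0 2
  /-- side-by-side (spatial) composition -/
  | tensor {a b c d : ℕ} (D₁ : Diagram a b) (D₂ : Diagram c d) : Diagram (a + c) (b + d)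
  /-- sequential composition `D₂ ∘ D₁` (first `D₁`, then `D₂`) -/
  | comp {a b c : ℕ} (D₂ : Diagram b c) (D₁ : Diagram a b) : Diagram a c

infixr:80 " ∘ᴰ " => Diagram.comp
notation:85 D₁:85 " ⊗ᴰ " D₂:86 => (Diagram.tensor D₁ D₂ :)

namespace Diagram

/-- Transport of a diagram along equalities of its numbers of inputs and outputs. -/
def cast : {a b a' b' : ℕ} → a = a' → b = b' → Diagram a b → Diagram a' b'
  | _, _, _, _, rfl, rfl, D => D

/-- The `n`-fold tensor power of a diagram with one input and one output. -/
def tpow (D : Diagram 1 1) : (n : ℕ) → Diagram n n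
  | 0 => empty
  | n + 1 => tpow D n ⊗ᴰ D

/-- `n` parallel wires. -/
def ident (n : ℕ) : Diagram n n := tpow wire n

/-- The leftmost wire crosses `n` wires and becomes the rightmost one. -/
def crossing : (n : ℕ) → Diagram (1 + n) (n + 1)
  | 0 => wire
  | n + 1 => (ident n ⊗ᴰ swap) ∘ᴰ (crossing n ⊗ᴰ wire)

/-- Exchange of the two colours. -/
def colourSwap : {a b : ℕ} → Diagram a b → Diagram a b
  | _, _, Z n m α => X n m α
  | _, _, X n m α => Z n m α
  | _, _, H => H
  | _, _, empty => empty
  | _, _, wire => wire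
  | _, _, swap => swap
  | _, _, cup => cup
  | _, _, cap => cap
  | _, _, tensor D₁ D₂ => colourSwap D₁ ⊗ᴰ colourSwap D₂
  | _, _, comp D₂ D₁ => colourSwap D₂ ∘ᴰ colourSwap D₁

/-- Turning a diagram upside-down; the angles do not change. -/
def upsideDown : {a b : ℕ} → Diagram a b → Diagram b a
  | _, _, Z n m α => Z m n α
  | _, _, X n m α => X m n α
  | _, _, H => H
  | _, _, empty => empty
  | _, _, wire => wire
  | _, _, swap => swap
  | _, _, cup => cap
  | _, _, cap => cup
  | _, _, tensor D₁ D₂ => upsideDown D₁ ⊗ᴰ upsideDown D₂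
  | _, _, comp D₂ D₁ => upsideDown D₁ ∘ᴰ upsideDown D₂

/-- All angles of the (green and red) dots of the diagram belong to `S`. -/
def AnglesIn (S : Set Real.Angle) : {a b : ℕ} → Diagram a b → Prop
  | _, _, Z _ _ α => α ∈ S
  | _, _, X _ _ α => α ∈ S
  | _, _, tensor D₁ D₂ => AnglesIn S D₁ ∧ AnglesIn S D₂
  | _, _, comp D₂ D₁ => AnglesIn S D₂ ∧ AnglesIn S D₁
  | _, _, H => True
  | _, _, empty => True
  | _, _, wire => True
  | _, _, swap => True
  | _, _, cup => True
  | _, _, cap => True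

/-- The `θ`-fragment: all angles are multiples of `θ`. -/
def InFragment (θ : Real.Angle) {a b : ℕ} (D : Diagram a b) : Prop :=
  AnglesIn (AddSubgroup.zmultiples θ : Set Real.Angle) D

end Diagram

/-! ### Standard interpretation -/

/-- Matrices of linear maps `ℂ^(2^n) → ℂ^(2^m)`; the computational basis of `ℂ^(2^n)` is indexed
by bit strings of length `n`. Rows are outputs, columns are inputs. -/
abbrev QMatrix (n m : ℕ) : Type := Matrix (Fin m → Fin 2) (Fin n → Fin 2) ℂ

/-- Kronecker product, in terms of bit strings. -/
def QMatrix.kron {a b c d : ℕ} (M : QMatrix a b) (N : QMatrix c d) : QMatrix (a + c) (b + d) :=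
  Matrix.of fun x y =>
    M (fun i => x (Fin.castAdd d i)) (fun i => y (Fin.castAdd c i)) *
      N (fun i => x (Fin.natAdd b i)) (fun i => y (Fin.natAdd a i))

/-- The Hadamard matrix. -/
def hadamard : Matrix (Fin 2) (Fin 2) ℂ := ((Real.sqrt 2 : ℝ) : ℂ)⁻¹ • !![1, 1; 1, -1]

/-- The `n`-th tensor power of the Hadamard matrix. -/
def hadamardPow (n : ℕ) : QMatrix n n := Matrix.of fun x y => ∏ i, hadamard (x i) (y i)

/-- `|0…0⟩⟨0…0| + e^{iα} |1…1⟩⟨1…1|`; for `n = m = 0` this is the scalar `1 + e^{iα}`. -/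
def spider (n m : ℕ) (α : Real.Angle) : QMatrix n m :=
  Matrix.of fun x y =>
    (if (∀ i, x i = 0) ∧ (∀ j, y j = 0) then 1 else 0) +
      (if (∀ i, x i = 1) ∧ (∀ j, y j = 1) then (α.toCircle : ℂ) else 0)

/-- The standard interpretation of ZX-diagrams. -/
def interp : {n m : ℕ} → Diagram n m → QMatrix n m
  | _, _, .Z n m α => spider n m α
  | _, _, .X n m α => hadamardPow m * spider n m α * hadamardPow n
  | _, _, .H => Matrix.of fun x y => hadamard (x 0) (y 0)
  | _, _, .empty => 1
  | _, _, .wire => 1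
  | _, _, .swap => Matrix.of fun x y => if x 0 = y 1 ∧ x 1 = y 0 then 1 else 0
  | _, _, .cup => Matrix.of fun _ y => if y 0 = y 1 then 1 else 0
  | _, _, .cap => Matrix.of fun x _ => if x 0 = x 1 then 1 else 0
  | _, _, .tensor D₁ D₂ => QMatrix.kron (interp D₁) (interp D₂)
  | _, _, .comp D₂ D₁ => interp D₂ * interp D₁

/-! ### The calculus -/

section Calculus

open Diagram

/-- The angle `π / 2`. -/
def halfPi : Real.Angle := ((Real.pi / 2 : ℝ) : Real.Angle)

/-- The angle `π`. -/
def piAngle : Real.Angle := ((Real.pi : ℝ) : Real.Angle)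

/-- The scalar given by a green dot and a red dot joined by `k` wires; its interpretation is `√2`
for `k = 1` and `1 / √2` for `k = 3`. -/
def lines (k : ℕ) : Diagram 0 0 := X k 0 0 ∘ᴰ Z 0 k 0

/-- The scalar given by a green dot of angle `α` joined to a red dot of angle `π`; its
interpretation is `√2 e^{iα}`. -/
def phaseScalar (α : Real.Angle) : Diagram 0 0 := X 1 0 piAngle ∘ᴰ Z 0 1 α

/-- The defining equations: deformation of diagrams (the first two groups) and the rules of the
ZX-calculus proper (the third group). Colour-swapped and upside-down versions are added in
`Derives`. -/
inductive Rule : {a b : ℕ} → Diagram a b → Diagram a b → Prop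
  -- Diagrams form a strict compact closed symmetric monoidal category.
  | comp_assoc {a b c d : ℕ} (D₃ : Diagram c d) (D₂ : Diagram b c) (D₁ : Diagram a b) :
      Rule ((D₃ ∘ᴰ D₂) ∘ᴰ D₁) (D₃ ∘ᴰ (D₂ ∘ᴰ D₁))
  | id_comp {a b : ℕ} (D : Diagram a b) : Rule (ident b ∘ᴰ D) D
  | comp_id {a b : ℕ} (D : Diagram a b) : Rule (D ∘ᴰ ident a) D
  | tensor_assoc {a b c d e f : ℕ} (D₁ : Diagram a b) (D₂ : Diagram c d) (D₃ : Diagram e f) :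
      Rule (Diagram.cast (Nat.add_assoc a c e) (Nat.add_assoc b d f) ((D₁ ⊗ᴰ D₂) ⊗ᴰ D₃))
        (D₁ ⊗ᴰ (D₂ ⊗ᴰ D₃))
  | empty_tensor {a b : ℕ} (D : Diagram a b) :
      Rule (Diagram.cast (Nat.zero_add a) (Nat.zero_add b) (empty ⊗ᴰ D)) D
  | tensor_empty {a b : ℕ} (D : Diagram a b) : Rule (D ⊗ᴰ empty) D
  | interchange {a b c a' b' c' : ℕ} (D₂ : Diagram b c) (D₁ : Diagram a b)
      (E₂ : Diagram b' c') (E₁ : Diagram a' b') :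
      Rule ((D₂ ∘ᴰ D₁) ⊗ᴰ (E₂ ∘ᴰ E₁)) ((D₂ ⊗ᴰ E₂) ∘ᴰ (D₁ ⊗ᴰ E₁))
  | swap_swap : Rule (swap ∘ᴰ swap) (ident 2)
  | swap_natural {a b : ℕ} (D : Diagram a b) :
      Rule ((D ⊗ᴰ wire) ∘ᴰ crossing a) (crossing b ∘ᴰ (wire ⊗ᴰ D))
  | swap_cap : Rule (swap ∘ᴰ cap) cap
  | yanking : Rule ((cup ⊗ᴰ wire) ∘ᴰ (wire ⊗ᴰ cap)) wire
  -- Legs can be interchanged and bent.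
  | leg_interchange (n p q : ℕ) (α : Real.Angle) :
      Rule ((ident p ⊗ᴰ swap ⊗ᴰ ident q) ∘ᴰ Z n (p + 2 + q) α) (Z n (p + 2 + q) α)
  | leg_bend (n m : ℕ) (α : Real.Angle) :
      Rule ((Z (n + 1) m α ⊗ᴰ wire) ∘ᴰ (ident n ⊗ᴰ cap)) (Z n (m + 1) α)
  | hadamard_bend : Rule ((H ⊗ᴰ wire) ∘ᴰ cap) ((wire ⊗ᴰ H) ∘ᴰ cap)
  -- The rules of the ZX-calculus.
  /-- two green dots joined by `k + 1` wires merge -/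
  | S1 (a b c d k : ℕ) (α β : Real.Angle) :
      Rule ((ident b ⊗ᴰ Z (k + 1 + c) d β) ∘ᴰ
          Diagram.cast rfl (Nat.add_assoc b (k + 1) c) (Z a (b + (k + 1)) α ⊗ᴰ ident c))
        (Z (a + c) (b + d) (α + β))
  | S2 : Rule (Z 1 1 0) wire
  | S3 : Rule (Z 0 2 0) cap
  | B1 : Rule (lines 1 ⊗ᴰ (Z 1 2 0 ∘ᴰ X 0 1 0)) (X 0 1 0 ⊗ᴰ X 0 1 0)
  | B2 : Rule
      (lines 1 ⊗ᴰ ((X 2 1 0 ⊗ᴰ X 2 1 0) ∘ᴰ (wire ⊗ᴰ swap ⊗ᴰ wire) ∘ᴰ (Z 1 2 0 ⊗ᴰ Z 1 2 0)))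
      (Z 1 2 0 ∘ᴰ X 2 1 0)
  | K1 (n : ℕ) :
      Rule (Z 1 n 0 ∘ᴰ X 1 1 piAngle) (tpow (X 1 1 piAngle) n ∘ᴰ Z 1 n 0)
  | K2 (α : Real.Angle) :
      Rule (lines 1 ⊗ᴰ (X 1 1 piAngle ∘ᴰ Z 1 1 α))
        (phaseScalar α ⊗ᴰ (Z 1 1 (-α) ∘ᴰ X 1 1 piAngle))
  | EU : Rule H
      (Z 0 0 (-halfPi) ⊗ᴰ lines 3 ⊗ᴰ (Z 1 1 halfPi ∘ᴰ X 1 1 halfPi ∘ᴰ Z 1 1 halfPi))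
  | HC (n m : ℕ) (α : Real.Angle) :
      Rule (tpow H m ∘ᴰ Z n m α ∘ᴰ tpow H n) (X n m α)
  | IV : Rule (lines 3 ⊗ᴰ lines 1) empty
  | ZO : Rule (Z 0 0 piAngle ⊗ᴰ wire) (Z 0 0 piAngle ⊗ᴰ (X 0 1 0 ∘ᴰ Z 1 0 0))

/-- `Derives D₁ D₂` is `ZX ⊢ D₁ = D₂`: the least equivalence relation that contains all rules with
their colour-swapped and/or upside-down versions and that is closed under both compositions. -/
inductive Derives : {a b : ℕ} → Diagram a b → Diagram a b → Prop
  | rule {a b : ℕ} {D D' : Diagram a b} : Rule D D' → Derives D D'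
  | rule_colourSwap {a b : ℕ} {D D' : Diagram a b} :
      Rule D D' → Derives D.colourSwap D'.colourSwap
  | rule_upsideDown {a b : ℕ} {D D' : Diagram a b} :
      Rule D D' → Derives D.upsideDown D'.upsideDown
  | rule_colourSwap_upsideDown {a b : ℕ} {D D' : Diagram a b} :
      Rule D D' → Derives D.colourSwap.upsideDown D'.colourSwap.upsideDown
  | refl {a b : ℕ} (D : Diagram a b) : Derives D D
  | symm {a b : ℕ} {D D' : Diagram a b} : Derives D D' → Derives D' D
  | trans {a b : ℕ} {D D' D'' : Diagram a b} : Derives D D' → Derives D' D'' → Derives D D''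
  | tensor {a b c d : ℕ} {D D' : Diagram a b} {E E' : Diagram c d} :
      Derives D D' → Derives E E' → Derives (D ⊗ᴰ E) (D' ⊗ᴰ E')
  | comp {a b c : ℕ} {D D' : Diagram b c} {E E' : Diagram a b} :
      Derives D D' → Derives E E' → Derives (D ∘ᴰ E) (D' ∘ᴰ E')

/-- Completeness of the `θ`-fragment: any two diagrams of the fragment with the same standard
interpretation are provably equal (derivations may use diagrams with arbitrary angles). -/
def FragmentComplete (θ : Real.Angle) : Prop :=
  ∀ (n m : ℕ) (D₁ D₂ : Diagram n m), D₁.InFragment θ → D₂.InFragment θ →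
    interp D₁ = interp D₂ → Derives D₁ D₂

/-- Left-hand side of supplementarity: green dots `α` and `α + π`, of degree one, attached to a red
dot with one output. -/
def supLeft (α : Real.Angle) : Diagram 0 1 := X 2 1 0 ∘ᴰ (Z 0 1 α ⊗ᴰ Z 0 1 (α + piAngle))

/-- Right-hand side of supplementarity: a green dot `2α + π` attached by two wires to a red dot
with one output. -/
def supRight (α : Real.Angle) : Diagram 0 1 := X 2 1 0 ∘ᴰ Z 0 2 (α + α + piAngle)

end Calculus

/-- The angle `π / 4`. -/
def quarterPi : Real.Angle := ((Real.pi / 4 : ℝ) : Real.Angle)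

end ZX

end

/-! Non-derivability is shown by a second sound interpretation in which supplementarity fails. Each
wire carries the functions on an elementary abelian 2-group `Q`. Green dots copy the basis of `Q`
with a phase `phase α q`, `H` is the Fourier transform of `Q`, and red dots are green dots in the
Fourier basis.

Most rules use only that phases are multiplicative in the angle. K1 and ZO see only the angle `π`,
EU only the angles `±π/2`, and K2 asks for a reflection law under translation by `u`. `PhaseModel`
records these demands, and `PhaseModel.ev_eq_of_derives` shows that they suffice; upside-down and
colour-swapped rules come for free from `ev_upsideDown` and `ev_colourSwap`.

This leaves a freedom at other angles. On three qubits let `α` act by `e^{iα m(q)}`, where `m` takes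
the values 0, 5, -2, 3 at weights 0, 1, 2, 3. Modulo 4 this is the weight, so multiples of `π/2` act
as in the threefold tensor power of the standard interpretation, and `m(q) + m(q + 1) = 3` gives K2.
But `m` is not additive over the bits. In any phase model the right side of supplementarity vanishes
off the zero word (`val_supRight`), while at `π/4` the left side does not
(`val_supLeft_tripleModel`). -/

noncomputable section

set_option linter.unusedSectionVars false

namespace ZX

open Diagram

/-! ### Matrices indexed by words: Kronecker products, wire permutations, dots -/

section Tensors

variable {Q : Type} [Fintype Q] [DecidableEq Q]

/-- Matrices whose rows and columns are indexed by words over `Q`. -/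
abbrev WMatrix (Q : Type) (n m : ℕ) : Type := Matrix (Fin m → Q) (Fin n → Q) ℂ

/-- Kronecker product of matrices indexed by words. -/
def WMatrix.kron {a b c d : ℕ} (M : WMatrix Q a b) (N : WMatrix Q c d) :
    WMatrix Q (a + c) (b + d) :=
  Matrix.of fun x y =>
    M (fun i => x (Fin.castAdd d i)) (fun i => y (Fin.castAdd c i)) *
      N (fun i => x (Fin.natAdd b i)) (fun i => y (Fin.natAdd a i))

/-- Tensor power of a matrix. -/
def wpow (M : Matrix Q Q ℂ) (n : ℕ) : WMatrix Q n n := Matrix.of fun x y => ∏ i, M (x i) (y i)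

/-- Kronecker delta. -/
def kdelta {A : Type} [DecidableEq A] (a b : A) : ℂ := if a = b then 1 else 0

/-- The map given by a rearrangement of the wires. -/
def wperm {n m : ℕ} (e : Fin m ≃ Fin n) : WMatrix Q n m :=
  Matrix.of fun x y => kdelta x (y ∘ e)

/-- The dot of phase `f` in the basis formed by the columns of `M`. -/
def dot (M : Matrix Q Q ℂ) (n m : ℕ) (f : Q → ℂ) : WMatrix Q n m :=
  Matrix.of fun x y => ∑ q, f q * ((∏ i, M (x i) q) * ∏ j, M (y j) q)

/-- Rearrangement of wires, side by side. -/
def finAddCongr {a b c d : ℕ} (e : Fin b ≃ Fin a) (e' : Fin d ≃ Fin c) :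
    Fin (b + d) ≃ Fin (a + c) :=
  finSumFinEquiv.symm.trans ((e.sumCongr e').trans finSumFinEquiv)

theorem one_eq_kdelta {A : Type} [DecidableEq A] (a b : A) :
    (1 : Matrix A A ℂ) a b = kdelta a b := Matrix.one_apply

theorem kdelta_comm {A : Type} [DecidableEq A] (a b : A) : kdelta a b = kdelta b a := by
  simp only [kdelta, eq_comm]

theorem kdelta_iff {A B : Type} [DecidableEq A] [DecidableEq B] {a b : A} {c d : B}
    (h : a = b ↔ c = d) : kdelta a b = kdelta c d := by
  simp only [kdelta, h]

theorem sum_mul_kdelta {A : Type} [Fintype A] [DecidableEq A] (F : A → ℂ) (a : A) :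
    ∑ b, F b * kdelta b a = F a := by
  simp [kdelta]

theorem sum_mul_kdelta' {A : Type} [Fintype A] [DecidableEq A] (F : A → ℂ) (a : A) :
    ∑ b, F b * kdelta a b = F a := by
  simp [kdelta]

theorem sum_kdelta_mul {A : Type} [Fintype A] [DecidableEq A] (F : A → ℂ) (a : A) :
    ∑ b, kdelta b a * F b = F a := by
  simp [kdelta]

theorem sum_kdelta_mul' {A : Type} [Fintype A] [DecidableEq A] (F : A → ℂ) (a : A) :
    ∑ b, kdelta a b * F b = F a := by
  simp [kdelta]

theorem prod_kdelta {A : Type} [DecidableEq A] {n : ℕ} (x y : Fin n → A) :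
    ∏ i, kdelta (x i) (y i) = kdelta x y := by
  simp only [kdelta, Finset.prod_ite_zero, Finset.mem_univ, forall_true_left,
    Finset.prod_const_one, funext_iff]

theorem word_ext_add {a b : ℕ} {x y : Fin (a + b) → Q} :
    x = y ↔ (∀ i, x (Fin.castAdd b i) = y (Fin.castAdd b i)) ∧
      ∀ i, x (Fin.natAdd a i) = y (Fin.natAdd a i) := by
  constructor
  · rintro rfl
    exact ⟨fun _ => rfl, fun _ => rfl⟩
  · rintro ⟨h, h'⟩
    funext i
    exact Fin.addCases (motive := fun i => x i = y i) h h' i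

theorem sum_append {a b : ℕ} (F : (Fin (a + b) → Q) → ℂ) :
    ∑ z, F z = ∑ z₁ : Fin a → Q, ∑ z₂ : Fin b → Q, F (Fin.append z₁ z₂) := by
  rw [← Fintype.sum_prod_type', ← (Fin.appendEquiv a b).sum_comp]
  rfl

theorem sum_word_one (F : (Fin 1 → Q) → ℂ) : ∑ z, F z = ∑ q, F (fun _ => q) := by
  rw [← (Equiv.funUnique (Fin 1) Q).symm.sum_comp]
  rfl

theorem sum_word_two (F : (Fin 2 → Q) → ℂ) : ∑ z, F z = ∑ p, ∑ q, F ![p, q] := by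
  rw [← Fintype.sum_prod_type', ← (finTwoArrowEquiv Q).symm.sum_comp]
  rfl

theorem kron_mul_kron {a b c a' b' c' : ℕ} (M₂ : WMatrix Q b c) (M₁ : WMatrix Q a b)
    (N₂ : WMatrix Q b' c') (N₁ : WMatrix Q a' b') :
    (M₂.kron N₂ : WMatrix Q _ _) * M₁.kron N₁ = WMatrix.kron (M₂ * M₁) (N₂ * N₁) := by
  ext x y
  simp only [Matrix.mul_apply, WMatrix.kron, Matrix.of_apply, sum_append, Fin.append_left,
    Fin.append_right, Finset.sum_mul_sum]
  refine Finset.sum_congr rfl fun z _ => Finset.sum_congr rfl fun z' _ => ?_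
  ring

theorem kron_transpose {a b c d : ℕ} (M : WMatrix Q a b) (N : WMatrix Q c d) :
    (M.kron N).transpose = WMatrix.kron M.transpose N.transpose := rfl

theorem wpow_add (M : Matrix Q Q ℂ) (a b : ℕ) :
    wpow M (a + b) = (wpow M a).kron (wpow M b) := by
  ext x y
  simp [wpow, WMatrix.kron, Fin.prod_univ_add]

theorem wpow_mul (M N : Matrix Q Q ℂ) (n : ℕ) : wpow M n * wpow N n = wpow (M * N) n := by
  ext x y
  simp only [wpow, Matrix.mul_apply, Matrix.of_apply, Finset.prod_univ_sum, Fintype.piFinset_univ,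
    Finset.prod_mul_distrib]

theorem wpow_one (n : ℕ) : wpow (1 : Matrix Q Q ℂ) n = 1 := by
  ext x y
  simp only [wpow, Matrix.of_apply, Matrix.one_apply, Finset.prod_ite_zero, Finset.mem_univ,
    forall_true_left, Finset.prod_const_one, funext_iff]

theorem wperm_mul_apply {a b c : ℕ} (e : Fin c ≃ Fin b) (M : WMatrix Q a b)
    (x : Fin c → Q) (y : Fin a → Q) : ((wperm e : WMatrix Q b c) * M) x y = M (x ∘ e.symm) y := by
  have h (z : Fin b → Q) : kdelta x (z ∘ e) = kdelta (x ∘ e.symm) z :=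
    kdelta_iff (e.comp_symm_eq z x).symm
  simp only [Matrix.mul_apply, wperm, Matrix.of_apply, h, sum_kdelta_mul']

theorem mul_wperm_apply {a b c : ℕ} (e : Fin b ≃ Fin a) (M : WMatrix Q b c)
    (x : Fin c → Q) (y : Fin a → Q) : (M * (wperm e : WMatrix Q a b)) x y = M x (y ∘ e) := by
  simp only [Matrix.mul_apply, wperm, Matrix.of_apply, sum_mul_kdelta]

theorem wperm_mul_wperm {a b c : ℕ} (e : Fin c ≃ Fin b) (e' : Fin b ≃ Fin a) :
    (wperm e : WMatrix Q b c) * (wperm e' : WMatrix Q a b) = wperm (e.trans e') := by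
  ext x y
  rw [mul_wperm_apply]
  rfl

theorem wperm_refl (n : ℕ) : (wperm (Equiv.refl (Fin n)) : WMatrix Q n n) = 1 := by
  ext x y
  rw [one_eq_kdelta]
  rfl

theorem kron_wperm {a b c d : ℕ} (e : Fin b ≃ Fin a) (e' : Fin d ≃ Fin c) :
    WMatrix.kron (wperm e : WMatrix Q a b) (wperm e') = wperm (finAddCongr e e') := by
  ext x y
  have h : x = y ∘ finAddCongr e e' ↔
      ((fun i => x (Fin.castAdd d i)) = (fun i => y (Fin.castAdd c i)) ∘ e) ∧
        ((fun i => x (Fin.natAdd b i)) = (fun i => y (Fin.natAdd a i)) ∘ e') := by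
    rw [word_ext_add]
    simp [finAddCongr, funext_iff]
  simp only [WMatrix.kron, wperm, Matrix.of_apply, kdelta, h, ite_and]
  split_ifs <;> simp

theorem wpow_mul_dot (A M : Matrix Q Q ℂ) (n m : ℕ) (f : Q → ℂ) (x : Fin m → Q) (y : Fin n → Q) :
    (wpow A m * dot M n m f) x y = ∑ q, f q * ((∏ i, (A * M) (x i) q) * ∏ j, M (y j) q) := by
  simp only [wpow, dot, Matrix.mul_apply, Matrix.of_apply, Finset.mul_sum]
  rw [Finset.sum_comm]
  refine Finset.sum_congr rfl fun q _ => ?_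
  rw [Finset.prod_univ_sum, Fintype.piFinset_univ, Finset.sum_mul, Finset.mul_sum]
  refine Finset.sum_congr rfl fun z _ => ?_
  rw [Finset.prod_mul_distrib]
  ring

/-- Applying `A` to every leg changes the basis of the dot. The input legs meet the transpose of
`A`, hence the symmetry hypothesis. This yields both the rule HC and the colour swap of dots. -/
theorem wpow_mul_dot_mul_wpow (A M : Matrix Q Q ℂ) (hA : A.IsSymm) (n m : ℕ) (f : Q → ℂ) :
    wpow A m * dot M n m f * wpow A n = dot (A * M) n m f := by
  ext x y
  rw [Matrix.mul_apply]
  simp only [wpow_mul_dot]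
  simp only [wpow, dot, Matrix.of_apply, Finset.sum_mul]
  rw [Finset.sum_comm]
  refine Finset.sum_congr rfl fun q _ => ?_
  have : ∏ j, (A * M) (y j) q = ∑ z : Fin n → Q, (∏ j, M (z j) q) * ∏ j, A (z j) (y j) := by
    simp only [Matrix.mul_apply]
    rw [Finset.prod_univ_sum, Fintype.piFinset_univ]
    refine Finset.sum_congr rfl fun z _ => ?_
    rw [← Finset.prod_mul_distrib]
    refine Finset.prod_congr rfl fun i _ => ?_
    rw [hA.apply, mul_comm]
  rw [this, Finset.mul_sum, Finset.mul_sum]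
  refine Finset.sum_congr rfl fun z _ => ?_
  ring

theorem dot_transpose (M : Matrix Q Q ℂ) (n m : ℕ) (f : Q → ℂ) :
    (dot M n m f).transpose = dot M m n f := by
  ext x y
  simp only [dot, Matrix.transpose_apply, Matrix.of_apply]
  exact Finset.sum_congr rfl fun q _ => by ring

end Tensors

/-! ### Phase models; turning upside-down and swapping colours -/

/-- Data that interpret a wire by the functions on an elementary abelian 2-group `Q` with a
nondegenerate symmetric bicharacter `χ`. Dots are interpreted by means of a family of phases,
the Hadamard vertex by the normalised Fourier transform. -/
structure PhaseModel (Q : Type) [Fintype Q] [DecidableEq Q] [AddCommGroup Q] where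
  χ : Q → Q → ℂ
  s : ℂ
  phase : Real.Angle → Q → ℂ
  u : Q
  u_ne_zero : u ≠ 0
  s_ne_zero : s ≠ 0
  add_self : ∀ a : Q, a + a = 0
  χ_symm : ∀ a b, χ a b = χ b a
  χ_zero : ∀ a, χ 0 a = 1
  χ_add : ∀ a b q, χ (a + b) q = χ a q * χ b q
  sum_χ : ∀ a, ∑ q, χ a q = if a = 0 then (s ^ 2)⁻¹ else 0
  phase_zero : ∀ q, phase 0 q = 1
  phase_add : ∀ α β q, phase (α + β) q = phase α q * phase β q
  phase_pi : ∀ q, phase piAngle q = χ u q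
  phase_reflect : ∀ α q, phase α q = phase α u * phase (-α) (q + u)
  euler : ∀ a b, χ a b = (∑ q, phase (-halfPi) q) * s ^ 2 * (phase halfPi a * phase halfPi b) *
    ∑ q, phase halfPi q * χ (a + b) q

namespace PhaseModel

variable {Q : Type} [Fintype Q] [DecidableEq Q] [AddCommGroup Q] (P : PhaseModel Q)

/-- The matrix of the Hadamard vertex. -/
def fourier : Matrix Q Q ℂ := Matrix.of fun a b => P.s * P.χ a b

/-- Interpretation of diagrams in a phase model. -/
def ev : {n m : ℕ} → Diagram n m → WMatrix Q n m
  | _, _, .Z n m α => dot 1 n m (P.phase α)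
  | _, _, .X n m α => dot P.fourier n m (P.phase α)
  | _, _, .H => wpow P.fourier 1
  | _, _, .empty => 1
  | _, _, .wire => 1
  | _, _, .swap => wperm (Equiv.swap 0 1)
  | _, _, .cup => Matrix.of fun _ y => kdelta (y 0) (y 1)
  | _, _, .cap => Matrix.of fun x _ => kdelta (x 0) (x 1)
  | _, _, .tensor D₁ D₂ => WMatrix.kron (ev D₁) (ev D₂)
  | _, _, .comp D₂ D₁ => ev D₂ * ev D₁

theorem fourier_symm : P.fourier.IsSymm := by
  ext a b
  simp [fourier, P.χ_symm a b]

theorem χ_mul_self (a q : Q) : P.χ a q * P.χ a q = 1 := by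
  rw [← P.χ_add, P.add_self, P.χ_zero]

theorem add_eq_zero_iff (P : PhaseModel Q) (a b : Q) : a + b = 0 ↔ a = b := by
  have h := P.add_self b
  constructor
  · intro h'
    exact add_right_cancel (h'.trans h.symm)
  · rintro rfl
    exact h

/-- Since `Q` has exponent 2, the product of the entries at `(a, q)` and `(q, b)` is a multiple of
`χ (a + b) q`, so orthogonality of characters applies and no complex conjugate is needed. -/
theorem fourier_mul_self : P.fourier * P.fourier = 1 := by
  ext a b
  have h : ∀ q, P.fourier a q * P.fourier q b = P.s ^ 2 * P.χ (a + b) q := fun q => by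
    rw [P.χ_add, P.χ_symm b]
    simp only [fourier, Matrix.of_apply]
    ring
  rw [Matrix.mul_apply, Finset.sum_congr rfl fun q _ => h q, ← Finset.mul_sum, P.sum_χ,
    Matrix.one_apply]
  have := P.s_ne_zero
  simp only [P.add_eq_zero_iff]
  split_ifs
  · field_simp
  · rw [mul_zero]

theorem ev_cast {a b a' b' : ℕ} (h : a = a') (h' : b = b') (D : Diagram a b)
    (x : Fin b' → Q) (y : Fin a' → Q) :
    P.ev (Diagram.cast h h' D) x y = P.ev D (x ∘ Fin.cast h') (y ∘ Fin.cast h) := by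
  subst h h'
  rfl

theorem ev_ident (n : ℕ) : P.ev (ident n) = 1 := by
  rw [← wpow_one]
  induction n with
  | zero => rw [wpow_one]; rfl
  | succ n ih =>
    rw [wpow_add, ← ih, wpow_one]
    rfl

theorem ev_tpow (D : Diagram 1 1) (M : Matrix Q Q ℂ) (hD : P.ev D = wpow M 1) (n : ℕ) :
    P.ev (tpow D n) = wpow M n := by
  induction n with
  | zero =>
    ext x y
    simp [tpow, ev, wpow, Subsingleton.elim x y]
  | succ n ih =>
    rw [wpow_add, ← ih, ← hD]
    rfl

/-- Soundness of a rule thus passes to its upside-down version by transposing. For `H` this rests on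
the symmetry of the Fourier matrix. -/
theorem ev_upsideDown {n m : ℕ} (D : Diagram n m) :
    P.ev D.upsideDown = (P.ev D).transpose := by
  induction D with
  | Z n m α => exact (dot_transpose _ _ _ _).symm
  | X n m α => exact (dot_transpose _ _ _ _).symm
  | H =>
    ext x y
    simp [ev, upsideDown, wpow, P.fourier_symm.apply]
  | empty => exact Matrix.transpose_one.symm
  | wire => exact Matrix.transpose_one.symm
  | swap =>
    ext x y
    refine kdelta_iff ?_
    simp only [funext_iff, Fin.forall_fin_two, Function.comp_apply, Equiv.swap_apply_left,
      Equiv.swap_apply_right]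
    exact ⟨fun h => ⟨h.2.symm, h.1.symm⟩, fun h => ⟨h.2.symm, h.1.symm⟩⟩
  | cup => rfl
  | cap => rfl
  | tensor D₁ D₂ h₁ h₂ =>
    simp only [upsideDown, ev, h₁, h₂, kron_transpose]
  | comp D₂ D₁ h₂ h₁ =>
    simp only [upsideDown, ev, h₁, h₂, Matrix.transpose_mul]

/-- The Fourier matrix `F` is an involution, so the factors between composed diagrams cancel. The
cap and the cup are unchanged because `F` times its transpose is the identity. Soundness of a rule
therefore passes to its colour-swapped version. -/
theorem ev_colourSwap {n m : ℕ} (D : Diagram n m) :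
    P.ev D.colourSwap = wpow P.fourier m * P.ev D * wpow P.fourier n := by
  have hpow (n : ℕ) : wpow P.fourier n * wpow P.fourier n = 1 := by
    rw [wpow_mul, P.fourier_mul_self, wpow_one]
  have hcap : wpow P.fourier 2 * P.ev cap = P.ev cap := by
    ext x y
    have h := congrFun (congrFun P.fourier_mul_self (x 0)) (x 1)
    rw [Matrix.mul_apply, one_eq_kdelta] at h
    simp only [ev, Matrix.mul_apply, wpow, Matrix.of_apply, sum_word_two, Fin.prod_univ_two,
      Matrix.cons_val_zero, Matrix.cons_val_one, sum_mul_kdelta']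
    rw [← h]
    exact Finset.sum_congr rfl fun q _ => by rw [P.fourier_symm.apply q (x 1)]
  have hcup : P.ev cup * wpow P.fourier 2 = P.ev cup := by
    have h := congrArg Matrix.transpose hcap
    rw [Matrix.transpose_mul, ← P.ev_upsideDown, upsideDown] at h
    convert h using 2
    ext x y
    simp [wpow, P.fourier_symm.apply]
  induction D with
  | Z n m α =>
    rw [colourSwap, ev, ev, wpow_mul_dot_mul_wpow _ _ P.fourier_symm, mul_one]
  | X n m α =>
    rw [colourSwap, ev, ev, wpow_mul_dot_mul_wpow _ _ P.fourier_symm, P.fourier_mul_self]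
  | H => rw [colourSwap, ev, hpow, one_mul]
  | empty =>
    rw [colourSwap, ev, mul_one, hpow]
  | wire =>
    rw [colourSwap, ev, mul_one, hpow]
  | swap =>
    have h : wpow P.fourier 2 * P.ev swap = P.ev swap * wpow P.fourier 2 := by
      ext x y
      rw [ev, mul_wperm_apply, wperm_mul_apply]
      simp [wpow, Fin.prod_univ_two, mul_comm]
    rw [colourSwap, h, mul_assoc, hpow, mul_one]
  | cup =>
    rw [colourSwap, Matrix.mul_assoc, hcup]
    ext x y
    simp [wpow, Matrix.mul_apply, Subsingleton.elim x default]
  | cap =>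
    rw [colourSwap, hcap]
    ext x y
    simp [wpow, Matrix.mul_apply, Subsingleton.elim y default]
  | tensor D₁ D₂ h₁ h₂ =>
    simp only [colourSwap, ev, h₁, h₂, wpow_add, kron_mul_kron]
  | @comp a b c D₂ D₁ h₂ h₁ =>
    simp only [colourSwap, ev, h₁, h₂]
    simp only [Matrix.mul_assoc]
    rw [← Matrix.mul_assoc (wpow P.fourier b) (wpow P.fourier b), hpow, Matrix.one_mul]

end PhaseModel

/-! ### Kronecker deltas on words and the flip of wires -/

section Dots

variable {Q : Type} [Fintype Q] [DecidableEq Q]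

theorem kdelta_add {a b : ℕ} (x y : Fin (a + b) → Q) :
    kdelta x y =
      kdelta (fun i => x (Fin.castAdd b i)) (fun i => y (Fin.castAdd b i)) *
        kdelta (fun i => x (Fin.natAdd a i)) (fun i => y (Fin.natAdd a i)) := by
  simp only [kdelta, word_ext_add (x := x), funext_iff, ite_and]
  split_ifs <;> simp

theorem kdelta_word_one (x y : Fin 1 → Q) : kdelta x y = kdelta (x 0) (y 0) :=
  kdelta_iff (by simp [funext_iff])

theorem kdelta_word_two (x y : Fin 2 → Q) :
    kdelta x y = kdelta (x 0) (y 0) * kdelta (x 1) (y 1) := by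
  rw [← prod_kdelta, Fin.prod_univ_two]

theorem kdelta_word_zero (x y : Fin 0 → Q) : kdelta x y = 1 :=
  if_pos (Subsingleton.elim _ _)

theorem kdelta_const_const (n : ℕ) (p q : Q) :
    kdelta (fun _ : Fin (n + 1) => p) (fun _ => q) = kdelta p q :=
  kdelta_iff ⟨fun h => congrFun h 0, fun h => h ▸ rfl⟩

theorem finAddCongr_castAdd {a b c d : ℕ} (e : Fin b ≃ Fin a) (e' : Fin d ≃ Fin c) (i : Fin b) :
    finAddCongr e e' (Fin.castAdd d i) = Fin.castAdd c (e i) := by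
  simp [finAddCongr]

theorem finAddCongr_natAdd {a b c d : ℕ} (e : Fin b ≃ Fin a) (e' : Fin d ≃ Fin c) (i : Fin d) :
    finAddCongr e e' (Fin.natAdd b i) = Fin.natAdd a (e' i) := by
  rw [finAddCongr, Equiv.trans_apply, finSumFinEquiv_symm_apply_natAdd]
  rfl

/-- The combinatorial form of the recursion defining `crossing`; it is the inductive step of
`ev_crossing`. -/
theorem finAddCongr_trans_finAddFlip (n : ℕ) :
    ((finAddCongr (Equiv.refl (Fin n)) (Equiv.swap (0 : Fin 2) 1)).trans
      (finAddCongr (finAddFlip (m := n) (n := 1)) (Equiv.refl (Fin 1)) :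
        Fin (n + 1 + 1) ≃ Fin (1 + n + 1))) = finAddFlip (m := n + 1) (n := 1) := by
  apply Equiv.ext
  intro i
  refine Fin.addCases (m := n) (n := 2) (fun j => ?_) (fun j => ?_) i
  · have h : Fin.castAdd 2 j = Fin.castAdd 1 (Fin.castAdd 1 j) := rfl
    rw [Equiv.trans_apply, finAddCongr_castAdd, h, finAddFlip_apply_castAdd, Equiv.refl_apply, h,
      finAddCongr_castAdd, finAddFlip_apply_castAdd]
    rfl
  · have h₁ : Fin.natAdd n (1 : Fin 2) = Fin.natAdd (n + 1) (0 : Fin 1) := rfl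
    have h₀ : Fin.natAdd n (0 : Fin 2) = Fin.castAdd 1 (Fin.natAdd n (0 : Fin 1)) := rfl
    rw [Equiv.trans_apply, finAddCongr_natAdd]
    fin_cases j
    · change finAddCongr finAddFlip (Equiv.refl (Fin 1))
        (Fin.natAdd n (Equiv.swap (0 : Fin 2) 1 0)) =
          finAddFlip (m := n + 1) (n := 1) (Fin.natAdd n (0 : Fin 2))
      rw [Equiv.swap_apply_left, h₁, h₀, finAddCongr_natAdd, finAddFlip_apply_castAdd]
      exact Fin.ext rfl
    · change finAddCongr finAddFlip (Equiv.refl (Fin 1))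
        (Fin.natAdd n (Equiv.swap (0 : Fin 2) 1 1)) =
          finAddFlip (m := n + 1) (n := 1) (Fin.natAdd n (1 : Fin 2))
      rw [Equiv.swap_apply_right, h₁, h₀, finAddCongr_castAdd, finAddFlip_apply_natAdd,
        finAddFlip_apply_natAdd]
      rfl

end Dots

/-! ### Soundness of the deformation rules and of spider merging -/

namespace PhaseModel

variable {Q : Type} [Fintype Q] [DecidableEq Q] [AddCommGroup Q] (P : PhaseModel Q)

/-- The entries of the interpretation of a diagram. -/
def val {n m : ℕ} (D : Diagram n m) (x : Fin m → Q) (y : Fin n → Q) : ℂ := P.ev D x y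

variable {P} in
theorem ev_ext {n m : ℕ} {D D' : Diagram n m} (h : ∀ x y, P.val D x y = P.val D' x y) :
    P.ev D = P.ev D' := Matrix.ext h

theorem val_comp {a b c : ℕ} (D₂ : Diagram b c) (D₁ : Diagram a b) (x : Fin c → Q)
    (y : Fin a → Q) : P.val (D₂ ∘ᴰ D₁) x y = ∑ z, P.val D₂ x z * P.val D₁ z y := rfl

theorem val_tensor {a b c d : ℕ} (D₁ : Diagram a b) (D₂ : Diagram c d)
    (x : Fin (b + d) → Q) (y : Fin (a + c) → Q) :
    P.val (D₁ ⊗ᴰ D₂) x y =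
      P.val D₁ (fun i => x (Fin.castAdd d i)) (fun i => y (Fin.castAdd c i)) *
        P.val D₂ (fun i => x (Fin.natAdd b i)) (fun i => y (Fin.natAdd a i)) := rfl

theorem val_cast {a b a' b' : ℕ} (h : a = a') (h' : b = b') (D : Diagram a b)
    (x : Fin b' → Q) (y : Fin a' → Q) :
    P.val (Diagram.cast h h' D) x y = P.val D (x ∘ Fin.cast h') (y ∘ Fin.cast h) :=
  P.ev_cast h h' D x y

theorem val_ident (n : ℕ) (x y : Fin n → Q) : P.val (ident n) x y = kdelta x y := by
  rw [val, ev_ident, one_eq_kdelta]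

theorem val_wire (x y : Fin 1 → Q) : P.val wire x y = kdelta (x 0) (y 0) := by
  rw [val, ev, one_eq_kdelta, kdelta_word_one]

theorem val_cap (x : Fin 2 → Q) (y : Fin 0 → Q) : P.val cap x y = kdelta (x 0) (x 1) := rfl

theorem val_cup (x : Fin 0 → Q) (y : Fin 2 → Q) : P.val cup x y = kdelta (y 0) (y 1) := rfl

theorem val_empty (x y : Fin 0 → Q) : P.val empty x y = 1 := by
  rw [val, ev, one_eq_kdelta, kdelta_word_zero]

theorem val_H (x y : Fin 1 → Q) : P.val H x y = P.s * P.χ (x 0) (y 0) := by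
  simp [val, ev, wpow, fourier]

theorem val_Z (n m : ℕ) (α : Real.Angle) (x : Fin m → Q) (y : Fin n → Q) :
    P.val (Z n m α) x y =
      ∑ q, P.phase α q * (kdelta x (fun _ => q) * kdelta y (fun _ => q)) := by
  have h (n : ℕ) (x : Fin n → Q) (q : Q) : ∏ i, kdelta (x i) q = kdelta x fun _ => q :=
    prod_kdelta x fun _ => q
  simp only [val, ev, dot, Matrix.of_apply, one_eq_kdelta, h]

theorem val_Z_one (m : ℕ) (α : Real.Angle) (x : Fin m → Q) (y : Fin 1 → Q) :
    P.val (Z 1 m α) x y = P.phase α (y 0) * kdelta x (fun _ => y 0) := by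
  simp only [val_Z, kdelta_word_one y, ← mul_assoc, sum_mul_kdelta']

theorem val_X (n m : ℕ) (α : Real.Angle) (x : Fin m → Q) (y : Fin n → Q) :
    P.val (X n m α) x y =
      ∑ q, P.phase α q * ((∏ i, P.s * P.χ (x i) q) * ∏ j, P.s * P.χ (y j) q) := rfl

theorem val_scalar_tensor {n m : ℕ} (D₁ : Diagram 0 0) (D₂ : Diagram n m)
    (x : Fin (0 + m) → Q) (y : Fin (0 + n) → Q) :
    P.val (D₁ ⊗ᴰ D₂) x y = P.val D₁ Fin.elim0 Fin.elim0 *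
      P.val D₂ (fun i => x (Fin.natAdd 0 i)) (fun i => y (Fin.natAdd 0 i)) := by
  rw [val_tensor]
  congr 2 <;> exact Subsingleton.elim _ _

theorem val_comp_of_left {a b c : ℕ} {E : Diagram b c} {e : Fin c ≃ Fin b} (h : P.ev E = wperm e)
    (D : Diagram a b) (x : Fin c → Q) (y : Fin a → Q) :
    P.val (E ∘ᴰ D) x y = P.val D (x ∘ e.symm) y := by
  rw [val, ev, h]
  exact wperm_mul_apply _ _ _ _

theorem val_comp_of_right {a b c : ℕ} {E : Diagram a b} {e : Fin b ≃ Fin a} (h : P.ev E = wperm e)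
    (D : Diagram b c) (x : Fin c → Q) (y : Fin a → Q) :
    P.val (D ∘ᴰ E) x y = P.val D x (y ∘ e) := by
  rw [val, ev, h]
  exact mul_wperm_apply _ _ _ _

theorem ev_crossing (n : ℕ) : P.ev (crossing n) = wperm (finAddFlip (m := n) (n := 1)) := by
  induction n with
  | zero =>
    have h : (finAddFlip (m := 0) (n := 1) : Fin (0 + 1) ≃ Fin (1 + 0)) = Equiv.refl (Fin 1) := by
      decide
    rw [h]
    exact (wperm_refl 1).symm
  | succ n ih =>
    have h₁ : P.ev (ident n ⊗ᴰ swap) =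
        wperm (finAddCongr (Equiv.refl (Fin n)) (Equiv.swap (0 : Fin 2) 1)) := by
      rw [ev, ev_ident, ev, ← wperm_refl, kron_wperm]
    have h₂ : P.ev (crossing n ⊗ᴰ wire) =
        wperm (finAddCongr (finAddFlip (m := n) (n := 1)) (Equiv.refl (Fin 1))) := by
      rw [ev, ih, ev, ← wperm_refl, kron_wperm]
    rw [← finAddCongr_trans_finAddFlip]
    refine Eq.trans ?_ (wperm_mul_wperm _ _)
    rw [← h₂]
    exact congrArg (fun M => M * P.ev (crossing n ⊗ᴰ wire)) h₁

theorem ev_tensor_assoc {a b c d e f : ℕ} (D₁ : Diagram a b) (D₂ : Diagram c d)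
    (D₃ : Diagram e f) :
    P.ev (Diagram.cast (Nat.add_assoc a c e) (Nat.add_assoc b d f) ((D₁ ⊗ᴰ D₂) ⊗ᴰ D₃)) =
      P.ev (D₁ ⊗ᴰ (D₂ ⊗ᴰ D₃)) := by
  have h (a c e : ℕ) (i : Fin e) : Fin.cast (Nat.add_assoc a c e) (Fin.natAdd (a + c) i) =
      Fin.natAdd a (Fin.natAdd c i) := Fin.ext (Nat.add_assoc a c i)
  refine ev_ext fun x y => ?_
  simp only [val_cast, val_tensor, Function.comp_apply, h, mul_assoc]
  rfl

theorem ev_empty_tensor {a b : ℕ} (D : Diagram a b) :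
    P.ev (Diagram.cast (Nat.zero_add a) (Nat.zero_add b) (empty ⊗ᴰ D)) = P.ev D := by
  have h (a : ℕ) (i : Fin a) : Fin.cast (Nat.zero_add a) (Fin.natAdd 0 i) = i :=
    Fin.ext (Nat.zero_add i)
  refine ev_ext fun x y => ?_
  simp only [val_cast, val_scalar_tensor, Function.comp_apply, h, val_empty, one_mul]

theorem ev_tensor_empty {a b : ℕ} (D : Diagram a b) : P.ev (D ⊗ᴰ empty) = P.ev D := by
  refine ev_ext fun x y => ?_
  rw [val_tensor, val_empty, mul_one]
  rfl

theorem ev_swap_swap : P.ev (swap ∘ᴰ swap) = P.ev (ident 2) := by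
  rw [ev_ident, ev, ev, wperm_mul_wperm, ← wperm_refl]
  congr 1
  decide

theorem ev_swap_natural {a b : ℕ} (D : Diagram a b) :
    P.ev ((D ⊗ᴰ wire) ∘ᴰ crossing a) = P.ev (crossing b ∘ᴰ (wire ⊗ᴰ D)) := by
  have h (n : ℕ) : (finAddFlip (m := n) (n := 1)).symm = finAddFlip := rfl
  refine ev_ext fun x y => ?_
  rw [P.val_comp_of_right (P.ev_crossing a), P.val_comp_of_left (P.ev_crossing b), h]
  simp only [val_tensor, val_wire, Function.comp_apply, finAddFlip_apply_castAdd,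
    finAddFlip_apply_natAdd]
  rw [mul_comm]

theorem ev_swap_cap : P.ev (swap ∘ᴰ cap) = P.ev cap := by
  refine ev_ext fun x y => ?_
  rw [P.val_comp_of_left (e := Equiv.swap 0 1) rfl, val_cap, val_cap, kdelta_comm]
  rfl

theorem ev_yanking : P.ev ((cup ⊗ᴰ wire) ∘ᴰ (wire ⊗ᴰ cap)) = P.ev wire := by
  refine ev_ext fun (x : Fin 1 → Q) (y : Fin 1 → Q) => ?_
  have h₁ (z : Fin 2 → Q) (r : Q) : P.val (cup ⊗ᴰ wire) x (Fin.append z fun _ : Fin 1 => r) =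
      kdelta (z 0) (z 1) * kdelta (x 0) r := by
    rw [val_tensor, val_cup, val_wire]
    simp only [Fin.append_left, Fin.append_right]
    rfl
  have h₂ (z : Fin 2 → Q) (r : Q) :
      P.val (wire ⊗ᴰ cap) (Fin.append (m := 2) z fun _ : Fin 1 => r) y =
        kdelta (z 0) (y 0) * kdelta (z 1) r := by
    rw [val_tensor, val_cap, val_wire]
    rfl
  rw [val_comp, sum_append (a := 2) (b := 1), val_wire]
  simp only [sum_word_one, sum_word_two, h₁, h₂, Matrix.cons_val_zero, Matrix.cons_val_one]
  simp [kdelta, eq_comm]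

theorem ev_hadamard_bend : P.ev ((H ⊗ᴰ wire) ∘ᴰ cap) = P.ev ((wire ⊗ᴰ H) ∘ᴰ cap) := by
  refine ev_ext fun (x : Fin 2 → Q) y => ?_
  have h₁ (p q : Q) : P.val (H ⊗ᴰ wire) x ![p, q] = P.s * P.χ (x 0) p * kdelta (x 1) q := by
    rw [val_tensor, val_H, val_wire]
    rfl
  have h₂ (p q : Q) : P.val (wire ⊗ᴰ H) x ![p, q] = kdelta (x 0) p * (P.s * P.χ (x 1) q) := by
    rw [val_tensor, val_H, val_wire]
    rfl
  rw [val_comp, val_comp, sum_word_two, sum_word_two]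
  simp only [h₁, h₂, val_cap, Matrix.cons_val_zero, Matrix.cons_val_one]
  simp [kdelta, P.χ_symm (x 0)]

theorem ev_leg_interchange (n p q : ℕ) (α : Real.Angle) :
    P.ev ((ident p ⊗ᴰ swap ⊗ᴰ ident q) ∘ᴰ Z n (p + 2 + q) α) = P.ev (Z n (p + 2 + q) α) := by
  have h : P.ev (ident p ⊗ᴰ swap ⊗ᴰ ident q) = wperm (finAddCongr
      (finAddCongr (Equiv.refl (Fin p)) (Equiv.swap (0 : Fin 2) 1)) (Equiv.refl (Fin q))) := by
    rw [ev, ev, ev_ident, ev, ev_ident, ← wperm_refl, ← wperm_refl, kron_wperm, kron_wperm]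
  refine ev_ext fun x y => ?_
  rw [P.val_comp_of_left h, val_Z, val_Z]
  refine Finset.sum_congr rfl fun r _ => ?_
  rw [← prod_kdelta, ← prod_kdelta x]
  congr 2
  exact Equiv.prod_comp (Equiv.symm _) fun i => kdelta (x i) r

theorem ev_leg_bend (n m : ℕ) (α : Real.Angle) :
    P.ev ((Z (n + 1) m α ⊗ᴰ wire) ∘ᴰ (ident n ⊗ᴰ cap)) = P.ev (Z n (m + 1) α) := by
  refine ev_ext (n := n) fun x y => ?_
  have h₁ (z : Fin n → Q) (w : Fin 2 → Q) (r : Q) :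
      kdelta (fun i : Fin (n + 1) => Fin.append z w (Fin.castAdd 1 i)) (fun _ => r) =
        kdelta z (fun _ => r) * kdelta (w 0) r := by
    rw [kdelta_add, kdelta_word_one]
    have h (i : Fin n) : Fin.castAdd 1 (Fin.castAdd 1 i) = Fin.castAdd 2 i := rfl
    have h' : Fin.castAdd 1 (Fin.natAdd n (0 : Fin 1)) = Fin.natAdd n (0 : Fin 2) := rfl
    simp only [h, h', Fin.append_left, Fin.append_right]
  have h₂ (z : Fin n → Q) (w : Fin 2 → Q) :
      Fin.append z w (Fin.natAdd (n + 1) (0 : Fin 1)) = w 1 :=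
    Fin.append_right z w 1
  have h₃ : (fun i => y (Fin.castAdd 0 i)) = y := rfl
  rw [val_comp, sum_append (a := n) (b := 2)]
  simp only [val_tensor, val_ident, val_wire, val_cap, val_Z, kdelta_add (a := m) (b := 1) x,
    h₁, h₂, h₃, Fin.append_left, Fin.append_right, kdelta_word_one, sum_word_two,
    Matrix.cons_val_zero, Matrix.cons_val_one]
  simp only [mul_left_comm _ (kdelta _ y), ← Finset.mul_sum, sum_kdelta_mul]
  simp only [← mul_assoc, sum_mul_kdelta']
  rw [← sum_mul_kdelta' (fun q => P.phase α q * kdelta (fun i => x (Fin.castAdd 1 i)) (fun _ => q) *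
    kdelta y fun _ => q)]
  exact Finset.sum_congr rfl fun p _ => by ring

theorem kdelta_append_const {a b : ℕ} (z : Fin a → Q) (w : Fin b → Q) (q : Q) :
    kdelta (Fin.append z w) (fun _ => q) = kdelta z (fun _ => q) * kdelta w (fun _ => q) := by
  simp only [kdelta_add (Fin.append z w), Fin.append_left, Fin.append_right]

/-- Each dot forces its legs to carry a common value, `p` for one and `q` for the other. The `k + 1`
joining wires form a nonempty word, so they force `p = q`, and the phases multiply by `phase_add`.
-/
theorem ev_S1 (a b c d k : ℕ) (α β : Real.Angle) :
    P.ev ((ident b ⊗ᴰ Z (k + 1 + c) d β) ∘ᴰ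
      Diagram.cast rfl (Nat.add_assoc b (k + 1) c) (Z a (b + (k + 1)) α ⊗ᴰ ident c)) =
      P.ev (Z (a + c) (b + d) (α + β)) := by
  refine ev_ext fun x y => ?_
  rw [val_comp, sum_append]
  have hy (h : a + c = a + c) : y ∘ Fin.cast h = y := rfl
  simp only [sum_append (a := k + 1), val_cast, hy]
  simp only [← Fin.append_assoc, val_tensor, val_ident, val_Z, kdelta_add x,
    kdelta_add y, Fin.append_left, Fin.append_right, P.phase_add, kdelta_append_const]
  generalize (fun i => x (Fin.castAdd d i)) = x₁
  generalize (fun i => x (Fin.natAdd b i)) = x₂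
  generalize (fun i => y (Fin.castAdd c i)) = y₁
  generalize (fun i => y (Fin.natAdd a i)) = y₂
  simp only [← mul_assoc, sum_mul_kdelta]
  simp only [mul_assoc, ← Finset.mul_sum, sum_kdelta_mul']
  simp only [Finset.sum_mul_sum]
  rw [Finset.sum_comm]
  refine Finset.sum_congr rfl fun q _ => ?_
  have h (F : Q → ℂ) : ∑ p, F p * kdelta p q = ∑ p, ∑ z : Fin (k + 1) → Q,
      F p * (kdelta z (fun _ => p) * kdelta z fun _ => q) := by
    simp only [← Finset.mul_sum, sum_kdelta_mul, kdelta_const_const]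
  rw [Finset.sum_comm, ← sum_mul_kdelta (fun p => P.phase α p * (P.phase β q *
    (kdelta x₁ (fun _ => p) * (kdelta x₂ (fun _ => q) * (kdelta y₁ (fun _ => p) *
      kdelta y₂ fun _ => q))))), h]
  refine Finset.sum_congr rfl fun p _ => Finset.sum_congr rfl fun z _ => ?_
  ring

end PhaseModel

/-! ### Soundness of the bialgebra, `π`, Euler and scalar rules -/

namespace PhaseModel

variable {Q : Type} [Fintype Q] [DecidableEq Q] [AddCommGroup Q] (P : PhaseModel Q)

theorem sum_χ_eq_kdelta (a : Q) : ∑ q, P.χ a q = (P.s ^ 2)⁻¹ * kdelta a 0 := by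
  rw [P.sum_χ, kdelta, mul_ite, mul_one, mul_zero]

theorem kdelta_add_zero (P : PhaseModel Q) (a b : Q) : kdelta (a + b) 0 = kdelta a b :=
  kdelta_iff (P.add_eq_zero_iff a b)

theorem kdelta_add_right (P : PhaseModel Q) (a b c : Q) : kdelta (a + b) c = kdelta a (b + c) := by
  rw [← P.kdelta_add_zero, ← P.kdelta_add_zero a, add_assoc]

theorem val_X_one_zero (x : Fin 1 → Q) (y : Fin 0 → Q) :
    P.val (X 0 1 0) x y = P.s⁻¹ * kdelta (x 0) 0 := by
  simp only [val_X, Fin.prod_univ_one, Fin.prod_univ_zero, P.phase_zero, one_mul, mul_one,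
    ← Finset.mul_sum, sum_χ_eq_kdelta]
  field_simp [P.s_ne_zero]

/-- Orthogonality of characters turns the red dot into addition in `Q`. Of the factors, `s ^ 3`
comes from the legs and `s ^ (-2)` from the character sum. -/
theorem val_X_two_one (x : Fin 1 → Q) (y : Fin 2 → Q) :
    P.val (X 2 1 0) x y = P.s * kdelta (x 0) (y 0 + y 1) := by
  have h (q : Q) : P.s * P.χ (x 0) q * (P.s * P.χ (y 0) q * (P.s * P.χ (y 1) q)) =
      P.s ^ 3 * P.χ (x 0 + (y 0 + y 1)) q := by
    rw [P.χ_add, P.χ_add]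
    ring
  simp only [val_X, Fin.prod_univ_one, Fin.prod_univ_two, P.phase_zero, one_mul, h,
    ← Finset.mul_sum, sum_χ_eq_kdelta, P.kdelta_add_zero]
  field_simp [P.s_ne_zero]

theorem val_X_one_one (α : Real.Angle) (x y : Fin 1 → Q) :
    P.val (X 1 1 α) x y = P.s ^ 2 * ∑ q, P.phase α q * P.χ (x 0 + y 0) q := by
  simp only [val_X, Fin.prod_univ_one, P.χ_add, Finset.mul_sum]
  exact Finset.sum_congr rfl fun q _ => by ring

theorem sum_phase_pi (a : Q) :
    ∑ q, P.phase piAngle q * P.χ a q = (P.s ^ 2)⁻¹ * kdelta a P.u := by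
  simp only [P.phase_pi, ← P.χ_add, sum_χ_eq_kdelta, P.kdelta_add_zero, kdelta_comm a]

/-- The phase of `π` is the character `χ u`, whose Fourier transform is concentrated at `u`. -/
theorem val_X_pi (x y : Fin 1 → Q) :
    P.val (X 1 1 piAngle) x y = kdelta (x 0) (y 0 + P.u) := by
  rw [val_X_one_one, sum_phase_pi, P.kdelta_add_right]
  field_simp [P.s_ne_zero]

theorem val_lines (k : ℕ) (x y : Fin 0 → Q) :
    P.val (lines k) x y = ∑ q, ∑ p, (P.s * P.χ p q) ^ k := by
  have h (q : Q) (z : Fin k → Q) : (∏ i, P.s * P.χ (z i) q) * P.val (Z 0 k 0) z y =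
      ∑ p, (∏ i, P.s * P.χ (z i) q) * kdelta z (fun _ => p) := by
    simp only [val_Z, P.phase_zero, kdelta_word_zero, one_mul, mul_one, Finset.mul_sum]
  rw [lines, val_comp]
  simp only [val_X, Fin.prod_univ_zero, P.phase_zero, one_mul, Finset.sum_mul, h]
  rw [Finset.sum_comm]
  refine Finset.sum_congr rfl fun q _ => ?_
  rw [Finset.sum_comm]
  simp only [sum_mul_kdelta, Finset.prod_const, Finset.card_univ, Fintype.card_fin]

theorem val_lines_one (x y : Fin 0 → Q) : P.val (lines 1) x y = P.s⁻¹ := by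
  have h (q : Q) : ∑ p, P.χ p q = (P.s ^ 2)⁻¹ * kdelta q 0 := by
    simp only [P.χ_symm _ q, sum_χ_eq_kdelta]
  simp only [val_lines, pow_one, ← Finset.mul_sum, h]
  simp only [kdelta, Finset.sum_ite_eq', Finset.mem_univ, if_true]
  field_simp [P.s_ne_zero]

/-- `χ` squares to 1, so two of the three wires only contribute `s ^ 2`, as in the Hopf law. -/
theorem val_lines_three (x y : Fin 0 → Q) : P.val (lines 3) x y = P.s := by
  have h (p q : Q) : (P.s * P.χ p q) ^ 3 = P.s ^ 2 * (P.s * P.χ p q) ^ 1 := by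
    linear_combination P.s ^ 3 * P.χ p q * P.χ_mul_self p q
  rw [val_lines]
  simp only [h, ← Finset.mul_sum]
  rw [← P.val_lines 1 x y, val_lines_one]
  field_simp [P.s_ne_zero]

theorem val_phaseScalar (α : Real.Angle) (x y : Fin 0 → Q) :
    P.val (phaseScalar α) x y = P.s⁻¹ * P.phase α P.u := by
  have h (z : Fin 1 → Q) (x : Fin 0 → Q) :
      P.val (X 1 0 piAngle) x z = P.s⁻¹ * kdelta (z 0) P.u := by
    simp only [val_X, Fin.prod_univ_zero, Fin.prod_univ_one, one_mul, mul_left_comm _ P.s,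
      ← Finset.mul_sum, sum_phase_pi]
    field_simp [P.s_ne_zero]
  rw [phaseScalar, val_comp, sum_word_one]
  simp only [h, val_Z, kdelta_word_one, kdelta_word_zero, mul_one, sum_mul_kdelta', mul_assoc,
    ← Finset.mul_sum, sum_kdelta_mul]

theorem ev_S2 : P.ev (Z 1 1 0) = P.ev wire := by
  refine ev_ext fun x y => ?_
  rw [val_Z_one, val_wire, P.phase_zero, one_mul, kdelta_word_one]

theorem ev_S3 : P.ev (Z 0 2 0) = P.ev cap := by
  refine ev_ext fun x y => ?_
  simp only [val_Z, val_cap, P.phase_zero, kdelta_word_zero, kdelta_word_two, one_mul, mul_one,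
    sum_mul_kdelta']

theorem ev_B1 : P.ev (lines 1 ⊗ᴰ (Z 1 2 0 ∘ᴰ X 0 1 0)) = P.ev (X 0 1 0 ⊗ᴰ X 0 1 0) := by
  refine ev_ext fun (x : Fin 2 → Q) y => ?_
  have h : P.val (X 0 1 0 ⊗ᴰ X 0 1 0) x y =
      (P.s⁻¹ * kdelta (x 0) 0) * (P.s⁻¹ * kdelta (x 1) 0) := by
    rw [val_tensor, val_X_one_zero, val_X_one_zero]
    rfl
  have h' : (fun i : Fin 2 => x (Fin.natAdd 0 i)) = x := by
    funext i
    fin_cases i <;> rfl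
  refine Eq.trans ?_ h.symm
  refine (P.val_scalar_tensor _ _ _ _).trans ?_
  rw [val_lines_one, val_comp, sum_word_one, h']
  simp only [val_Z_one, val_X_one_zero, P.phase_zero, one_mul, mul_left_comm _ P.s⁻¹,
    ← Finset.mul_sum, sum_mul_kdelta, kdelta_word_two]
  ring

theorem ev_B2 : P.ev
    (lines 1 ⊗ᴰ ((X 2 1 0 ⊗ᴰ X 2 1 0) ∘ᴰ (wire ⊗ᴰ swap ⊗ᴰ wire) ∘ᴰ (Z 1 2 0 ⊗ᴰ Z 1 2 0))) =
      P.ev (Z 1 2 0 ∘ᴰ X 2 1 0) := by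
  refine ev_ext (n := 2) (m := 2) fun x y => ?_
  have h' (x : Fin 2 → Q) : (fun i : Fin 2 => x (Fin.natAdd 0 i)) = x := by
    funext i
    fin_cases i <;> rfl
  have hσ : P.ev (wire ⊗ᴰ swap ⊗ᴰ wire) = wperm (finAddCongr
      (finAddCongr (Equiv.refl (Fin 1)) (Equiv.swap (0 : Fin 2) 1)) (Equiv.refl (Fin 1))) := by
    have h : P.ev wire = wperm (Equiv.refl (Fin 1)) := (wperm_refl 1).symm
    rw [ev, h, ev, h, ev, kron_wperm, kron_wperm]
  have h₁ (z w : Fin 2 → Q) : P.val (X 2 1 0 ⊗ᴰ X 2 1 0) x (Fin.append z w) =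
      (P.s * kdelta (x 0) (z 0 + z 1)) * (P.s * kdelta (x 1) (w 0 + w 1)) := by
    rw [val_tensor, val_X_two_one, val_X_two_one]
    simp only [Fin.append_left, Fin.append_right]
    rfl
  have h₂ (p q r t : Q) : P.val ((wire ⊗ᴰ swap ⊗ᴰ wire) ∘ᴰ (Z 1 2 0 ⊗ᴰ Z 1 2 0))
      (Fin.append (m := 2) (n := 2) ![p, q] ![r, t]) y =
        kdelta p (y 0) * (kdelta q (y 1) * (kdelta r (y 0) * kdelta t (y 1))) := by
    refine (P.val_comp_of_left hσ _ _ _).trans ?_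
    rw [val_tensor, val_Z_one, val_Z_one, P.phase_zero, P.phase_zero, one_mul, one_mul,
      kdelta_word_two, kdelta_word_two]
    -- The crossing exchanges the two middle legs: `p, r` come from the first copy dot and `q, t`
    -- from the second.
    change (kdelta p (y 0) * kdelta r (y 0)) * (kdelta q (y 1) * kdelta t (y 1)) = _
    ring
  refine (P.val_scalar_tensor _ _ _ _).trans ?_
  rw [h', h', val_lines_one, val_comp, val_comp, sum_word_one, sum_append (a := 2) (b := 2)]
  simp only [sum_word_two, h₁, h₂, val_Z_one, val_X_two_one, P.phase_zero, one_mul,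
    Matrix.cons_val_zero, Matrix.cons_val_one, kdelta_word_two]
  simp only [← mul_assoc, sum_mul_kdelta]
  field_simp [P.s_ne_zero]

/-- Translation by `u` permutes the basis that the green dot copies. -/
theorem ev_K1 (n : ℕ) :
    P.ev (Z 1 n 0 ∘ᴰ X 1 1 piAngle) = P.ev (tpow (X 1 1 piAngle) n ∘ᴰ Z 1 n 0) := by
  refine ev_ext fun x y => ?_
  have hX : P.ev (X 1 1 piAngle) = wpow (Matrix.of fun a b => kdelta a (b + P.u)) 1 := by
    ext x y
    refine (P.val_X_pi x y).trans ?_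
    simp [wpow]
  have h (z : Fin n → Q) : P.val (tpow (X 1 1 piAngle) n) x z = ∏ i, kdelta (x i) (z i + P.u) := by
    rw [val, P.ev_tpow _ _ hX]
    rfl
  rw [val_comp, val_comp, sum_word_one]
  simp only [h, val_Z_one, val_X_pi, P.phase_zero, one_mul, sum_mul_kdelta]
  exact (prod_kdelta x fun _ => y 0 + P.u).symm

theorem ev_K2 (α : Real.Angle) : P.ev (lines 1 ⊗ᴰ (X 1 1 piAngle ∘ᴰ Z 1 1 α)) =
    P.ev (phaseScalar α ⊗ᴰ (Z 1 1 (-α) ∘ᴰ X 1 1 piAngle)) := by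
  refine ev_ext fun x y => ?_
  rw [val_scalar_tensor, val_scalar_tensor, val_lines_one, val_phaseScalar, val_comp, val_comp,
    sum_word_one, sum_word_one]
  simp only [val_Z_one, val_X_pi, kdelta_word_one]
  simp only [← mul_assoc, sum_mul_kdelta]
  rw [P.phase_reflect α]
  ring

theorem ev_EU : P.ev H = P.ev
    (Z 0 0 (-halfPi) ⊗ᴰ lines 3 ⊗ᴰ (Z 1 1 halfPi ∘ᴰ X 1 1 halfPi ∘ᴰ Z 1 1 halfPi)) := by
  refine ev_ext fun (x : Fin 1 → Q) (y : Fin 1 → Q) => ?_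
  have h' (x : Fin 1 → Q) : (fun i : Fin 1 => x (Fin.natAdd 0 i)) = x := by
    funext i
    fin_cases i; rfl
  rw [val_H, P.euler]
  refine Eq.symm ((P.val_scalar_tensor _ _ _ _).trans ?_)
  rw [h', h', val_comp, sum_word_one]
  simp only [val_comp, sum_word_one, val_Z_one, val_X_one_one, kdelta_word_one]
  have h : P.val (Z 0 0 (-halfPi) ⊗ᴰ lines 3) Fin.elim0 Fin.elim0 =
      (∑ q, P.phase (-halfPi) q) * P.s := by
    refine (P.val_scalar_tensor _ _ _ _).trans ?_
    simp only [val_lines_three, val_Z, kdelta_word_zero, mul_one]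
  simp only [h, ← mul_assoc, sum_mul_kdelta]
  simp only [mul_right_comm _ (kdelta (x 0) _), sum_mul_kdelta']
  ring

theorem ev_HC (n m : ℕ) (α : Real.Angle) :
    P.ev (tpow H m ∘ᴰ Z n m α ∘ᴰ tpow H n) = P.ev (X n m α) := by
  change P.ev (tpow H m) * (P.ev (Z n m α) * P.ev (tpow H n)) = _
  rw [P.ev_tpow H P.fourier rfl, P.ev_tpow H P.fourier rfl, ← Matrix.mul_assoc]
  exact (wpow_mul_dot_mul_wpow _ _ P.fourier_symm _ _ _).trans (by rw [mul_one]; rfl)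

theorem ev_IV : P.ev (lines 3 ⊗ᴰ lines 1) = P.ev empty := by
  refine ev_ext fun x y => ?_
  rw [val_empty]
  refine (P.val_scalar_tensor _ _ _ _).trans ?_
  rw [val_lines_one, val_lines_three, mul_inv_cancel₀ P.s_ne_zero]

/-- The scalar is the sum of the nontrivial character `χ u`. Both sides of ZO carry it as a factor.
-/
theorem val_Z_pi (x y : Fin 0 → Q) : P.val (Z 0 0 piAngle) x y = 0 := by
  simp only [val_Z, kdelta_word_zero, mul_one, P.phase_pi, P.sum_χ, P.u_ne_zero, if_false]

theorem ev_ZO : P.ev (Z 0 0 piAngle ⊗ᴰ wire) =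
    P.ev (Z 0 0 piAngle ⊗ᴰ (X 0 1 0 ∘ᴰ Z 1 0 0)) := by
  refine ev_ext fun x y => ?_
  rw [val_scalar_tensor, val_scalar_tensor, val_Z_pi, zero_mul, zero_mul]

theorem ev_eq_of_rule {n m : ℕ} {D D' : Diagram n m} (h : Rule D D') : P.ev D = P.ev D' := by
  cases h with
  | comp_assoc => exact Matrix.mul_assoc _ _ _
  | id_comp => rw [ev, ev_ident, Matrix.one_mul]
  | comp_id => rw [ev, ev_ident, Matrix.mul_one]
  | tensor_assoc => exact P.ev_tensor_assoc _ _ _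
  | empty_tensor => exact P.ev_empty_tensor _
  | tensor_empty => exact P.ev_tensor_empty _
  | interchange => exact (kron_mul_kron _ _ _ _).symm
  | swap_swap => exact P.ev_swap_swap
  | swap_natural => exact P.ev_swap_natural _
  | swap_cap => exact P.ev_swap_cap
  | yanking => exact P.ev_yanking
  | leg_interchange => exact P.ev_leg_interchange _ _ _ _
  | leg_bend => exact P.ev_leg_bend _ _ _
  | hadamard_bend => exact P.ev_hadamard_bend
  | S1 => exact P.ev_S1 _ _ _ _ _ _ _
  | S2 => exact P.ev_S2
  | S3 => exact P.ev_S3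
  | B1 => exact P.ev_B1
  | B2 => exact P.ev_B2
  | K1 => exact P.ev_K1 _
  | K2 => exact P.ev_K2 _
  | EU => exact P.ev_EU
  | HC => exact P.ev_HC _ _ _
  | IV => exact P.ev_IV
  | ZO => exact P.ev_ZO

/-- Every phase model is sound for the calculus. -/
theorem ev_eq_of_derives {n m : ℕ} {D D' : Diagram n m} (h : Derives D D') :
    P.ev D = P.ev D' := by
  induction h with
  | rule h => exact P.ev_eq_of_rule h
  | rule_colourSwap h => rw [ev_colourSwap, ev_colourSwap, P.ev_eq_of_rule h]
  | rule_upsideDown h => rw [ev_upsideDown, ev_upsideDown, P.ev_eq_of_rule h]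
  | rule_colourSwap_upsideDown h =>
    rw [ev_upsideDown, ev_upsideDown, ev_colourSwap, ev_colourSwap, P.ev_eq_of_rule h]
  | refl => rfl
  | symm _ ih => exact ih.symm
  | trans _ _ ih ih' => exact ih.trans ih'
  | tensor _ _ ih ih' => rw [ev, ev, ih, ih']
  | comp _ _ ih ih' => rw [ev, ev, ih, ih']

end PhaseModel

/-! ### A phase model on three qubits -/

/-- The nontrivial character of `ZMod 2`. -/
def sign (t : ZMod 2) : ℂ := if t = 0 then 1 else -1

/-- Hamming weight of a bit triple. -/
def weight (q : Fin 3 → ZMod 2) : ℤ := ∑ i, ((q i).val : ℤ)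

/-- The multiplicity with which an angle acts on a bit triple. It agrees with the weight modulo `4`;
its values at weight `0, 1, 2, 3` are `0, 5, -2, 3`. -/
def multiplicity (q : Fin 3 → ZMod 2) : ℤ :=
  weight q + 2 * (weight q * (3 - weight q) * (3 - 2 * weight q))

/-- The cubic `w (3 - w) (3 - 2 w)` takes even values, so the correction to the weight is a multiple
of 4. -/
theorem multiplicity_mod_four (q : Fin 3 → ZMod 2) :
    ∃ k, multiplicity q = weight q + 4 * k := by
  have h : ∀ q, (multiplicity q - weight q) % 4 = 0 := by decide
  exact ⟨(multiplicity q - weight q) / 4, by have := h q; omega⟩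

/-- Adding `1` complements the bits and sends the weight `w` to `3 - w`; the cubic correction is odd
under this reflection. -/
theorem multiplicity_reflect : ∀ q : Fin 3 → ZMod 2,
    multiplicity q = multiplicity 1 - multiplicity (q + 1) := by decide

/-- Phases that are fourth roots of unity see only the weight, so they split over the three bits.
This reduces the axioms at `π` and `±π/2` to one bit. -/
theorem zpow_multiplicity {z : ℂ} (hz : z ^ 4 = 1) (q : Fin 3 → ZMod 2) :
    z ^ multiplicity q = ∏ i, z ^ (q i).val := by
  have h0 : z ≠ 0 := by
    rintro rfl
    norm_num at hz
  obtain ⟨k, hk⟩ := multiplicity_mod_four q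
  have h4 : z ^ (4 : ℤ) = 1 := by exact_mod_cast hz
  rw [hk, zpow_add₀ h0, zpow_mul, h4, one_zpow, mul_one, weight, Finset.prod_pow_eq_pow_sum]
  exact_mod_cast rfl

theorem sum_prod_bits (F : Fin 3 → ZMod 2 → ℂ) :
    ∑ q : Fin 3 → ZMod 2, ∏ i, F i (q i) = ∏ i, ∑ t, F i t := by
  rw [Finset.prod_univ_sum, Fintype.piFinset_univ]

theorem sum_bit (F : ZMod 2 → ℂ) : ∑ t, F t = F 0 + F 1 := Fin.sum_univ_two F

theorem forall_bit {p : ZMod 2 → Prop} : (∀ t, p t) ↔ p 0 ∧ p 1 := Fin.forall_fin_two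

theorem toCircle_halfPi : (halfPi.toCircle : ℂ) = Complex.I := by
  rw [halfPi, Real.Angle.toCircle_coe, Circle.coe_exp]
  push_cast
  exact Complex.exp_pi_div_two_mul_I

theorem toCircle_piAngle : (piAngle.toCircle : ℂ) = -1 := by
  rw [piAngle, Real.Angle.toCircle_coe, Circle.coe_exp, Complex.exp_pi_mul_I]

theorem sign_mul_add : ∀ a b q : ZMod 2, sign ((a + b) * q) = sign (a * q) * sign (b * q) := by
  have h : (1 + 1 : ZMod 2) = 0 := rfl
  simp [forall_bit, sign, h]

theorem sum_sign (a : ZMod 2) : ∑ t, sign (a * t) = if a = 0 then 2 else 0 := by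
  revert a
  simp [forall_bit, sum_bit, sign]
  norm_num

/-- The Euler decomposition of the one-qubit Hadamard gate with denominators cleared; the 2 is the
order of `ZMod 2`. -/
theorem one_bit_euler : ∀ a b : ZMod 2, 2 * sign (a * b) =
    (∑ t : ZMod 2, (-Complex.I) ^ t.val) * (Complex.I ^ a.val * Complex.I ^ b.val) *
      ∑ t : ZMod 2, Complex.I ^ t.val * sign ((a + b) * t) := by
  have h : (1 + 1 : ZMod 2) = 0 := rfl
  have h1 : (1 : ZMod 2).val = 1 := rfl
  have hI := Complex.I_sq
  simp only [forall_bit, sum_bit]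
  refine ⟨⟨?_, ?_⟩, ?_, ?_⟩ <;> simp [sign, h, h1]
  · linear_combination hI
  · linear_combination (2 - Complex.I) * hI
  · linear_combination (2 - Complex.I) * hI
  · linear_combination -hI

/-- Every wire becomes three wires, and an angle acts on the three wires jointly. -/
def tripleModel : PhaseModel (Fin 3 → ZMod 2) where
  χ a b := ∏ i, sign (a i * b i)
  s := ((Real.sqrt 8 : ℝ) : ℂ)⁻¹
  phase α q := (α.toCircle : ℂ) ^ multiplicity q
  u := 1
  u_ne_zero := by decide
  s_ne_zero := by simp
  add_self := by decide
  χ_symm a b := by simp only [mul_comm]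
  χ_zero a := by simp [sign]
  χ_add a b q := by simp only [Pi.add_apply, sign_mul_add, Finset.prod_mul_distrib]
  sum_χ a := by
    have hs : (((Real.sqrt 8 : ℝ) : ℂ)⁻¹ ^ 2)⁻¹ = 2 ^ 3 := by
      rw [inv_pow, inv_inv, ← Complex.ofReal_pow, Real.sq_sqrt (by norm_num)]
      norm_num
    rw [sum_prod_bits fun i t => sign (a i * t), hs]
    simp only [sum_sign, Finset.prod_ite_zero, Finset.mem_univ, forall_true_left, funext_iff,
      Finset.prod_const, Finset.card_univ, Fintype.card_fin, Pi.zero_apply]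
  phase_zero q := by simp
  phase_add α β q := by simp [Real.Angle.toCircle_add, mul_zpow]
  phase_pi q := by
    have h : ∀ t : ZMod 2, (-1 : ℂ) ^ t.val = sign (1 * t) := by
      have h1 : (1 : ZMod 2).val = 1 := rfl
      simp [forall_bit, sign, h1]
    rw [toCircle_piAngle, zpow_multiplicity (by norm_num)]
    simp only [h, Pi.one_apply]
  phase_reflect α q := by
    rw [Real.Angle.toCircle_neg, Circle.coe_inv, inv_zpow', ← zpow_add₀ (Circle.coe_ne_zero _),
      multiplicity_reflect q, sub_eq_add_neg]
  euler a b := by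
    have hs : ((Real.sqrt 8 : ℝ) : ℂ)⁻¹ ^ 2 = (2 ^ 3)⁻¹ := by
      rw [inv_pow, ← Complex.ofReal_pow, Real.sq_sqrt (by norm_num)]
      norm_num
    have hI : (-Complex.I) ^ 4 = 1 := by rw [neg_pow, Complex.I_pow_four]; norm_num
    simp only [Real.Angle.toCircle_neg, Circle.coe_inv, toCircle_halfPi, Complex.inv_I, hs,
      zpow_multiplicity Complex.I_pow_four, zpow_multiplicity hI, Pi.add_apply,
      ← Finset.prod_mul_distrib]
    -- Both sums factor over the bits, so the identity is the product of three instances of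
    -- `one_bit_euler`; the resulting `2 ^ 3` cancels `s ^ 2 = 1 / 8`.
    rw [sum_prod_bits fun _ t => (-Complex.I) ^ t.val,
      sum_prod_bits fun i t => Complex.I ^ t.val * sign ((a i + b i) * t)]
    have h := Finset.prod_congr rfl fun i (_ : i ∈ Finset.univ) => one_bit_euler (a i) (b i)
    simp only [Finset.prod_mul_distrib, Finset.prod_const, Finset.card_univ, Fintype.card_fin]
      at h ⊢
    field_simp
    linear_combination h

/-! ### Supplementarity in phase models -/

/-- The two wires carry the same `q`, and `q + q = 0`, so the red dot outputs only the zero word. -/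
theorem val_supRight {Q : Type} [Fintype Q] [DecidableEq Q] [AddCommGroup Q] (P : PhaseModel Q)
    (α : Real.Angle) {x : Fin 1 → Q} (hx : x 0 ≠ 0) (y : Fin 0 → Q) :
    P.val (supRight α) x y = 0 := by
  rw [supRight, PhaseModel.val_comp]
  refine Finset.sum_eq_zero fun z _ => ?_
  rw [P.val_X_two_one, P.val_Z, Finset.mul_sum]
  refine Finset.sum_eq_zero fun q _ => ?_
  by_cases hz : z = fun _ => q
  · subst hz
    simp [P.add_self, kdelta, hx]
  · simp [kdelta, hz]

/-- The red dot adds its inputs, so the value is a convolution of the two phase functions. -/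
theorem val_supLeft {Q : Type} [Fintype Q] [DecidableEq Q] [AddCommGroup Q] (P : PhaseModel Q)
    (α : Real.Angle) (x : Fin 1 → Q) (y : Fin 0 → Q) :
    P.val (supLeft α) x y = P.s * ∑ q, P.phase α q * P.phase (α + piAngle) (q + x 0) := by
  have h (p q : Q) : P.val (Z 0 1 α ⊗ᴰ Z 0 1 (α + piAngle)) ![p, q] y =
      P.phase α p * P.phase (α + piAngle) q := by
    rw [PhaseModel.val_tensor, P.val_Z, P.val_Z]
    simp only [kdelta_word_one, kdelta_word_zero, mul_one, sum_mul_kdelta']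
    rfl
  have h' (p q : Q) : kdelta (x 0) (p + q) = kdelta q (p + x 0) := by
    rw [kdelta_comm, add_comm, P.kdelta_add_right]
  rw [supLeft, PhaseModel.val_comp, sum_word_two, Finset.mul_sum]
  refine Finset.sum_congr rfl fun p _ => ?_
  simp only [h, P.val_X_two_one, Matrix.cons_val_zero, Matrix.cons_val_one, h']
  rw [← sum_mul_kdelta (fun q => P.s * (P.phase α p * P.phase (α + piAngle) q))]
  exact Finset.sum_congr rfl fun q _ => by ring

theorem toCircle_quarterPi_sq : (quarterPi.toCircle : ℂ) ^ 2 = Complex.I := by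
  rw [← toCircle_halfPi, halfPi, quarterPi, Real.Angle.toCircle_coe, Real.Angle.toCircle_coe,
    Circle.coe_exp, Circle.coe_exp, ← Complex.exp_nat_mul]
  congr 1
  push_cast
  ring

/-- The word must be nonzero and of even weight. For an odd word `x` the terms at `q` and `q + x`
cancel, because multiplicity has the parity of the weight and `-1` is raised to exponents of
opposite parity. -/
theorem val_supLeft_tripleModel (y : Fin 0 → Fin 3 → ZMod 2) :
    tripleModel.val (supLeft quarterPi) (fun _ => ![1, 1, 0]) y ≠ 0 := by
  rw [val_supLeft]
  refine mul_ne_zero tripleModel.s_ne_zero ?_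
  have hz := toCircle_quarterPi_sq
  simp only [tripleModel, Real.Angle.toCircle_add, Circle.coe_mul, toCircle_piAngle]
  generalize (quarterPi.toCircle : ℂ) = z at hz
  have h0 : z ≠ 0 := by
    rintro rfl
    rw [zero_pow two_ne_zero] at hz
    exact Complex.I_ne_zero hz.symm
  rw [sum_append (a := 2) (b := 1)]
  simp only [sum_word_one, sum_word_two, sum_bit]
  have h (p q r : ZMod 2) : (Fin.append ![p, q] (fun _ : Fin 1 => r) : Fin 3 → ZMod 2) =
      ![p, q, r] := by
    funext i
    fin_cases i <;> rfl
  have m₀ : multiplicity ![0, 0, 0] = 0 := by decide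
  have m₁ : multiplicity ![0, 0, 1] = 5 := by decide
  have m₂ : multiplicity ![0, 1, 0] = 5 := by decide
  have m₃ : multiplicity ![0, 1, 1] = -2 := by decide
  have m₄ : multiplicity ![1, 0, 0] = 5 := by decide
  have m₅ : multiplicity ![1, 0, 1] = -2 := by decide
  have m₆ : multiplicity ![1, 1, 0] = -2 := by decide
  have m₇ : multiplicity ![1, 1, 1] = 3 := by decide
  have h2 : (1 + 1 : ZMod 2) = 0 := rfl
  simp only [h, Matrix.cons_add_cons, Matrix.empty_add_empty, add_zero, zero_add, h2, m₀, m₁, m₂,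
    m₃, m₄, m₅, m₆, m₇]
  have e₁ : z ^ (-2 : ℤ) = -Complex.I := by
    rw [zpow_neg, ← Complex.inv_I, ← hz]
    rfl
  have e₂ : (z * -1) ^ (-2 : ℤ) = -Complex.I := by
    rw [mul_zpow, e₁]
    norm_num
  simp only [e₁, e₂, zpow_ofNat]
  have h8 : z ^ 8 = 1 := by rw [show z ^ 8 = (z ^ 2) ^ 4 by ring, hz, Complex.I_pow_four]
  intro h
  -- The eight terms form equal pairs `q`, `q + (1, 1, 0)`, with sums `2 z⁻² = -2i`, `-2 z¹⁰ = -2i`,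
  -- `-2 z⁸ = -2` and `2 z⁻⁴ = -2`. With the plain weight as exponent the sum would be `2z² - 2z² -
  -- 2z⁴ + 2z⁴ = 0`.
  have h' : (-4 : ℂ) - 4 * Complex.I = 0 := by
    rw [← h]
    linear_combination (2 + 2 * z ^ 2) * h8 + 2 * hz - 2 * Complex.I_sq
  simpa using congrArg Complex.re h'

theorem not_derives_supplementarity :
    ¬ Derives (supLeft quarterPi) (supRight quarterPi) := by
  intro h
  refine val_supLeft_tripleModel Fin.elim0 ?_
  rw [PhaseModel.val, tripleModel.ev_eq_of_derives h]
  exact val_supRight _ _ (by decide) _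

/-! ### Supplementarity in the standard interpretation and membership in the fragment -/

theorem interp_X_two_one (x : Fin 1 → Fin 2) (z : Fin 2 → Fin 2) :
    interp (X 2 1 0) x z =
      ((Real.sqrt 2 : ℝ) : ℂ)⁻¹ * if x 0 = z 0 + z 1 then 1 else 0 := by
  have h : interp (X 2 1 0) x z = ∑ w, (∑ v, hadamardPow 1 x v * spider 2 1 0 v w) *
    hadamardPow 2 w z := rfl
  have h2 : (((Real.sqrt 2 : ℝ) : ℂ)⁻¹) ^ 2 = 1 / 2 := by
    rw [inv_pow, ← Complex.ofReal_pow, Real.sq_sqrt (by norm_num)]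
    norm_num
  rw [h]
  simp only [sum_word_one, sum_word_two, hadamardPow, spider, Matrix.of_apply, Fin.prod_univ_one,
    Fin.prod_univ_two, Fin.sum_univ_two, Fin.forall_fin_one, Fin.forall_fin_two, hadamard]
  generalize x 0 = a
  generalize z 0 = b
  generalize z 1 = c
  revert a b c
  generalize ((Real.sqrt 2 : ℝ) : ℂ)⁻¹ = s at h2
  simp [Fin.forall_fin_two]
  -- What remains amounts to `2 s ^ 3 = s`.
  linear_combination 2 * s * h2

/-- Up to the common factor `1 / √2`, both sides give `1 - e^{2iα}` at output 0. At output 1 the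
left side is `-e^{iα} + e^{iα} = 0`, and the right side vanishes since its two wires agree. -/
theorem interp_supplementarity (α : Real.Angle) : interp (supLeft α) = interp (supRight α) := by
  ext (x : Fin 1 → Fin 2) (y : Fin 0 → Fin 2)
  have hl : interp (supLeft α) x y = ∑ z, interp (X 2 1 0) x z *
    (spider 0 1 α (fun i => z (Fin.castAdd 1 i)) (fun i => y (Fin.castAdd 0 i)) *
      spider 0 1 (α + piAngle) (fun i => z (Fin.natAdd 1 i)) (fun i => y (Fin.natAdd 0 i))) := rfl
  have hr : interp (supRight α) x y =
    ∑ z, interp (X 2 1 0) x z * spider 0 2 (α + α + piAngle) z y := rfl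
  rw [hl, hr]
  simp only [interp_X_two_one, sum_word_two, Fin.sum_univ_two, spider, Matrix.of_apply,
    Fin.forall_fin_one, Fin.forall_fin_two, Real.Angle.toCircle_add, Circle.coe_mul,
    toCircle_piAngle]
  generalize x 0 = a
  revert a
  simp

theorem piAngle_mem_zmultiples : piAngle ∈ AddSubgroup.zmultiples quarterPi := by
  refine ⟨4, ?_⟩
  change (4 : ℤ) • quarterPi = piAngle
  rw [quarterPi, piAngle, ← Real.Angle.coe_zsmul]
  congr 1
  simp
  ring

theorem inFragment_supLeft : (supLeft quarterPi).InFragment quarterPi :=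
  ⟨zero_mem _, AddSubgroup.mem_zmultiples _,
    add_mem (AddSubgroup.mem_zmultiples _) piAngle_mem_zmultiples⟩

theorem inFragment_supRight : (supRight quarterPi).InFragment quarterPi :=
  ⟨zero_mem _, add_mem (add_mem (AddSubgroup.mem_zmultiples _) (AddSubgroup.mem_zmultiples _))
    piAngle_mem_zmultiples⟩

end ZX

end

theorem corollary3 :
    ((ZX.supLeft ZX.quarterPi).InFragment ZX.quarterPi ∧
      (ZX.supRight ZX.quarterPi).InFragment ZX.quarterPi ∧
      ZX.interp (ZX.supLeft ZX.quarterPi) = ZX.interp (ZX.supRight ZX.quarterPi) ∧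
      ¬ ZX.Derives (ZX.supLeft ZX.quarterPi) (ZX.supRight ZX.quarterPi)) ∧
    ¬ ZX.FragmentComplete ZX.quarterPi :=
  ⟨⟨ZX.inFragment_supLeft, ZX.inFragment_supRight, ZX.interp_supplementarity _,
    ZX.not_derives_supplementarity⟩, fun h => ZX.not_derives_supplementarity
      (h _ _ _ _ ZX.inFragment_supLeft ZX.inFragment_supRight (ZX.interp_supplementarity _))⟩
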